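/- Let $(\tilde M,\varphi,\xi,\eta,\langle\,,\rangle)$ be a $(2m+1)$-dimensional contact metric manifold: $\tilde M$ is a smooth manifold with a smooth Riemannian metric $\langle\,,\rangle$, a smooth $(1,1)$-tensor field $\varphi$, a smooth vector field $\xi$ and a smooth $1$-form $\eta$ such that $$\varphi^2=-I+\eta\otimes\xi,\qquad \eta(\xi)=1,\qquad \langle X,Y\rangle=\langle\varphi X,\varphi Y\rangle+\eta(X)\eta(Y),\qquad \langle X,\varphi Y\rangle=d\eta(X,Y)$$ for all $X,Y\in T\tilde M$, where $2\,d\eta(X,Y)=X\eta(Y)-Y\eta(X)-\eta([X,Y])$. Let $M$ be an $n$-dimensional Riemannian manifold isometrically immersed in $\tilde M$ such that $\xi$ is tangent to $M$ at every point of $M$. Let $\tilde\nabla$ be the Levi-Civita connection of $\tilde M$, let $\sigma(X,Y)=(\tilde\nabla_XY)^\perp$ be the second fundamental form of $M$ and let $H=\frac1n\operatorname{trace}\sigma$ be its mean curvature vector. If $M$ is totally umbilical, that is, if $\sigma(X,Y)=\langle X,Y\rangle H$ for all $X,Y\in TM$, then $M$ is minimal ($H=0$), and consequently $M$ is totally geodesic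 ($\sigma=0$). -/

import Mathlib

open Bundle Manifold VectorField
open scoped ContDiff

set_option linter.unusedSectionVars false

namespace SubmanifoldGeometry

/-! ### The Levi-Civita connection

Mathlib has covariant derivatives, their torsion and the Lie bracket of vector fields, but not the
Levi-Civita connection. It is built here from the Koszul formula; it is then proved to be
torsion-free and compatible with the metric. -/

section LeviCivita

variable {E : Type*} [NormedAddCommGroup E] [NormedSpace ℝ E]
  {H : Type*} [TopologicalSpace H] {I : ModelWithCorners ℝ E H}
  {M : Type*} [TopologicalSpace M] [ChartedSpace H M]
  [RiemannianBundle (fun x : M ↦ TangentSpace I x)]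

/-- Half the right-hand side of the Koszul formula, that is, the value that `⟨∇_X Y, Z⟩` must have
at `x`. -/
noncomputable def koszul (Y X Z : Π x : M, TangentSpace I x) (x : M) : ℝ :=
  (1 / 2) * (d% (fun y ↦ inner ℝ (Y y) (Z y)) x (X x) + d% (fun y ↦ inner ℝ (X y) (Z y)) x (Y x)
    - d% (fun y ↦ inner ℝ (X y) (Y y)) x (Z x)
    + inner ℝ (mlieBracket I X Y x) (Z x) - inner ℝ (mlieBracket I X Z x) (Y x)
    - inner ℝ (mlieBracket I Y Z x) (X x))

variable {X X' Y Y' Z : Π x : M, TangentSpace I x} {x : M}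

theorem mvfderiv_inner_comm :
    d% (fun y ↦ inner ℝ (X y) (Y y)) x = d% (fun y ↦ inner ℝ (Y y) (X y)) x := by
  simp only [real_inner_comm]

variable [IsManifold I ∞ M] [IsContMDiffRiemannianBundle I ∞ E (fun x : M ↦ TangentSpace I x)]

theorem mdiffAt_inner (hX : MDiffAt (T% X) x) (hY : MDiffAt (T% Y) x) :
    MDiffAt (fun y ↦ inner ℝ (X y) (Y y)) x :=
  MDifferentiableAt.inner_bundle (F := E) (E := fun x : M ↦ TangentSpace I x) hX hY

theorem mvfderiv_inner_add (hX : MDiffAt (T% X) x) (hX' : MDiffAt (T% X') x)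
    (hY : MDiffAt (T% Y) x) :
    d% (fun y ↦ inner ℝ ((X + X') y) (Y y)) x =
      d% (fun y ↦ inner ℝ (X y) (Y y)) x + d% (fun y ↦ inner ℝ (X' y) (Y y)) x := by
  rw [← mvfderiv_add (mdiffAt_inner hX hY) (mdiffAt_inner hX' hY)]
  congr 1
  ext y
  exact inner_add_left ..

theorem mvfderiv_inner_smul {f : M → ℝ} (hf : MDiffAt f x) (hX : MDiffAt (T% X) x)
    (hY : MDiffAt (T% Y) x) :
    d% (fun y ↦ inner ℝ ((f • X) y) (Y y)) x =
      f x • d% (fun y ↦ inner ℝ (X y) (Y y)) x + (inner ℝ (X x) (Y x) : ℝ) • d% f x := by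
  rw [← mvfderiv_mul hf (mdiffAt_inner hX hY)]
  congr 1
  ext y
  exact real_inner_smul_left ..

theorem mvfderiv_inner_add_right (hX : MDiffAt (T% X) x) (hX' : MDiffAt (T% X') x)
    (hY : MDiffAt (T% Y) x) :
    d% (fun y ↦ inner ℝ (Y y) ((X + X') y)) x =
      d% (fun y ↦ inner ℝ (Y y) (X y)) x + d% (fun y ↦ inner ℝ (Y y) (X' y)) x := by
  rw [mvfderiv_inner_comm, mvfderiv_inner_add hX hX' hY, mvfderiv_inner_comm (X := X),
    mvfderiv_inner_comm (X := X')]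

theorem mvfderiv_inner_smul_right {f : M → ℝ} (hf : MDiffAt f x) (hX : MDiffAt (T% X) x)
    (hY : MDiffAt (T% Y) x) :
    d% (fun y ↦ inner ℝ (Y y) ((f • X) y)) x =
      f x • d% (fun y ↦ inner ℝ (Y y) (X y)) x + (inner ℝ (Y x) (X x) : ℝ) • d% f x := by
  rw [mvfderiv_inner_comm, mvfderiv_inner_smul hf hX hY, mvfderiv_inner_comm (X := X),
    real_inner_comm]

variable [CompleteSpace E]

theorem koszul_add (hX : MDiffAt (T% X) x) (hZ : MDiffAt (T% Z) x)
    (hY : MDiffAt (T% Y) x) (hY' : MDiffAt (T% Y') x) :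
    koszul (Y + Y') X Z x = koszul Y X Z x + koszul Y' X Z x := by
  simp only [koszul, mvfderiv_inner_add hY hY' hZ, mvfderiv_inner_add_right hY hY' hX,
    mlieBracket_add_left hY hY', mlieBracket_add_right hY hY']
  simp [inner_add_left, inner_add_right]
  ring

theorem koszul_smul {f : M → ℝ} (hf : MDiffAt f x) (hX : MDiffAt (T% X) x)
    (hZ : MDiffAt (T% Z) x) (hY : MDiffAt (T% Y) x) :
    koszul (f • Y) X Z x =
      f x * koszul Y X Z x + d% f x (X x) * inner ℝ (Y x) (Z x) := by
  simp only [koszul, mvfderiv_inner_smul hf hY hZ, mvfderiv_inner_smul_right hf hY hX,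
    mlieBracket_smul_left hf hY, mlieBracket_smul_right hf hY]
  simp [inner_add_left, inner_smul_left, inner_smul_right]
  simp only [real_inner_comm]
  ring

theorem tensorialAt_koszul₁ (hY : MDiffAt (T% Y) x) (hZ : MDiffAt (T% Z) x) :
    TensorialAt I E (fun X ↦ koszul Y X Z x) x where
  smul {f X} hf hX := by
    simp only [koszul, mvfderiv_inner_smul hf hX hZ, mvfderiv_inner_smul hf hX hY,
      mlieBracket_smul_left hf hX]
    simp [inner_add_left, inner_smul_left, inner_smul_right]
    simp only [real_inner_comm]
    ring
  add {X X'} hX hX' := by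
    simp only [koszul, mvfderiv_inner_add hX hX' hZ, mvfderiv_inner_add hX hX' hY,
      mlieBracket_add_left hX hX']
    simp [inner_add_left, inner_add_right]
    ring

theorem tensorialAt_koszul₂ (hY : MDiffAt (T% Y) x) (hX : MDiffAt (T% X) x) :
    TensorialAt I E (fun Z ↦ koszul Y X Z x) x where
  smul {f Z} hf hZ := by
    simp only [koszul, mvfderiv_inner_smul_right hf hZ hX, mvfderiv_inner_smul_right hf hZ hY,
      mlieBracket_smul_right hf hZ]
    simp [inner_add_left, inner_smul_left, inner_smul_right]
    simp only [real_inner_comm]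
    ring
  add {Z Z'} hZ hZ' := by
    simp only [koszul, mvfderiv_inner_add_right hZ hZ' hX, mvfderiv_inner_add_right hZ hZ' hY,
      mlieBracket_add_right hZ hZ']
    simp [inner_add_left, inner_add_right]
    ring

variable [FiniteDimensional ℝ E]

instance (x : M) : FiniteDimensional ℝ (TangentSpace I x) := inferInstanceAs (FiniteDimensional ℝ E)

open Classical in
/-- The bilinear form `(u, w) ↦ ⟨∇_u Y, w⟩` on the tangent space at `x`, for a vector field `Y` that
is differentiable at `x` (and `0` otherwise). -/
noncomputable def koszulForm (Y : Π x : M, TangentSpace I x) (x : M) :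
    TangentSpace I x →L[ℝ] TangentSpace I x →L[ℝ] ℝ :=
  if hY : MDiffAt (T% Y) x then
    TensorialAt.mkHom₂ (F := E) (F' := E) (fun X Z ↦ koszul Y X Z x) x
      (fun _ hZ ↦ tensorialAt_koszul₁ hY hZ) (fun _ hX ↦ tensorialAt_koszul₂ hY hX)
  else 0

theorem koszulForm_apply (hY : MDiffAt (T% Y) x) (hX : MDiffAt (T% X) x)
    (hZ : MDiffAt (T% Z) x) : koszulForm Y x (X x) (Z x) = koszul Y X Z x := by
  rw [koszulForm, dif_pos hY]
  exact TensorialAt.mkHom₂_apply _ _ hX hZ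

/-- The linear map `u ↦ ∇_u Y` at `x`, obtained from `koszulForm` by raising an index. -/
noncomputable def koszulCov (Y : Π x : M, TangentSpace I x) (x : M) :
    TangentSpace I x →L[ℝ] TangentSpace I x :=
  ∑ i, ((koszulForm Y x).flip (stdOrthonormalBasis ℝ (TangentSpace I x) i)).smulRight
    (stdOrthonormalBasis ℝ (TangentSpace I x) i)

theorem inner_koszulCov (u w : TangentSpace I x) :
    inner ℝ (koszulCov Y x u) w = koszulForm Y x u w := by
  conv_rhs => rw [← (stdOrthonormalBasis ℝ (TangentSpace I x)).sum_repr' w]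
  simp [koszulCov, sum_inner, inner_smul_left, mul_comm]

theorem koszul_ext {a b : TangentSpace I x}
    (h : ∀ Z : Π x : M, TangentSpace I x, MDiffAt (T% Z) x →
      (inner ℝ a (Z x) : ℝ) = inner ℝ b (Z x)) : a = b := by
  refine ext_inner_right ℝ fun w ↦ ?_
  simpa using h (FiberBundle.extend E w) (FiberBundle.mdifferentiableAt_extend ..)


variable (I M) in
/-- The Levi-Civita connection of the Riemannian manifold `M`. As everywhere in Mathlib,
`leviCivita I M Y x u` is `∇_u Y` at the point `x`. -/
noncomputable def leviCivita : CovariantDerivative I E (fun x : M ↦ TangentSpace I x) where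
  toFun := koszulCov
  isCovariantDerivativeOnUniv :=
    { add := fun {Y Y' x} hY hY' _ ↦ by
        refine ContinuousLinearMap.ext fun u ↦ koszul_ext fun Z hZ ↦ ?_
        have hu := FiberBundle.mdifferentiableAt_extend I E u
        have e := koszul_add hu hZ hY hY'
        rw [← koszulForm_apply hY hu hZ, ← koszulForm_apply hY' hu hZ,
          ← koszulForm_apply (mdifferentiableAt_add_section hY hY') hu hZ] at e
        simp only [FiberBundle.extend_apply_self] at e
        simp only [inner_koszulCov, _root_.add_apply, inner_add_left]
        exact e
      leibniz := fun {Y f x} hY hf _ ↦ by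
        refine ContinuousLinearMap.ext fun u ↦ koszul_ext fun Z hZ ↦ ?_
        have hu := FiberBundle.mdifferentiableAt_extend I E u
        have e := koszul_smul hf hu hZ hY
        rw [← koszulForm_apply hY hu hZ,
          ← koszulForm_apply (hf.smul_section hY) hu hZ] at e
        simp only [FiberBundle.extend_apply_self] at e
        simp [inner_koszulCov, inner_add_left, inner_smul_left]
        exact e }

theorem inner_leviCivita (hX : MDiffAt (T% X) x) (hY : MDiffAt (T% Y) x) (hZ : MDiffAt (T% Z) x) :
    inner ℝ (leviCivita I M Y x (X x)) (Z x) = koszul Y X Z x :=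
  (inner_koszulCov _ _).trans (koszulForm_apply hY hX hZ)

theorem leviCivita_torsion : (leviCivita I M).torsion = 0 := by
  rw [CovariantDerivative.torsion_eq_zero_iff]
  intro X Y x hX hY
  refine koszul_ext fun Z hZ ↦ ?_
  rw [inner_sub_left, inner_leviCivita hX hY hZ, inner_leviCivita hY hX hZ]
  simp only [koszul, mlieBracket_swap_apply (V := Y) (W := X),
    mvfderiv_inner_comm (X := Y) (Y := X), inner_neg_left]
  ring

theorem leviCivita_metric (hY : MDiffAt (T% Y) x) (hZ : MDiffAt (T% Z) x) (u : TangentSpace I x) :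
    d% (fun y ↦ inner ℝ (Y y) (Z y)) x u =
      inner ℝ (leviCivita I M Y x u) (Z x) + inner ℝ (Y x) (leviCivita I M Z x u) := by
  have hu := FiberBundle.mdifferentiableAt_extend I E u
  have e1 := inner_leviCivita hu hY hZ
  have e2 := inner_leviCivita hu hZ hY
  rw [FiberBundle.extend_apply_self] at e1 e2
  rw [e1, real_inner_comm, e2]
  simp only [koszul, mlieBracket_swap_apply (V := Z) (W := Y),
    mvfderiv_inner_comm (X := Z) (Y := Y), inner_neg_left, FiberBundle.extend_apply_self]
  ring

end LeviCivita

/-! ### Contact metric structures -/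

section Contact

variable {E : Type*} [NormedAddCommGroup E] [NormedSpace ℝ E]
  {H : Type*} [TopologicalSpace H] {I : ModelWithCorners ℝ E H}
  {M : Type*} [TopologicalSpace M] [ChartedSpace H M]

/-- The exterior derivative of a `1`-form, evaluated on two vector fields, with the normalization
`2 dη(X, Y) = X (η Y) - Y (η X) - η [X, Y]` of contact metric geometry. -/
noncomputable def extDerivOneForm (η : Π x : M, TangentSpace I x →L[ℝ] ℝ)
    (X Y : Π x : M, TangentSpace I x) (x : M) : ℝ :=
  (1 / 2) * (d% (fun y ↦ η y (Y y)) x (X x) - d% (fun y ↦ η y (X y)) x (Y x)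
    - η x (mlieBracket I X Y x))

variable [RiemannianBundle (fun x : M ↦ TangentSpace I x)] [IsManifold I ∞ M]

variable (I M) in
/-- A contact metric structure `(φ, ξ, η, ⟨ , ⟩)` on a Riemannian manifold `(M, ⟨ , ⟩)`: an almost
contact structure `(φ, ξ, η)` with which the metric is compatible and for which the fundamental
`2`-form `Φ(X, Y) = ⟨X, φ Y⟩` equals `dη`. -/
structure ContactMetricStructure where
  /-- the `(1,1)`-tensor field -/
  φ : Π x : M, TangentSpace I x →L[ℝ] TangentSpace I x
  /-- the structure vector field -/
  ξ : Π x : M, TangentSpace I x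
  /-- the contact form -/
  η : Π x : M, TangentSpace I x →L[ℝ] ℝ
  contMDiff_φ : ContMDiff I (I.prod 𝓘(ℝ, E →L[ℝ] E)) ∞
    (fun x ↦ TotalSpace.mk' (E →L[ℝ] E)
      (E := fun x : M ↦ TangentSpace I x →L[ℝ] TangentSpace I x) x (φ x))
  contMDiff_ξ : ContMDiff I (I.prod 𝓘(ℝ, E)) ∞
    (fun x ↦ TotalSpace.mk' E (E := fun x : M ↦ TangentSpace I x) x (ξ x))
  contMDiff_η : ContMDiff I (I.prod 𝓘(ℝ, E →L[ℝ] ℝ)) ∞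
    (fun x ↦ TotalSpace.mk' (E →L[ℝ] ℝ)
      (E := fun x : M ↦ TangentSpace I x →L[ℝ] Bundle.Trivial M ℝ x) x (η x))
  φ_φ : ∀ (x : M) (u : TangentSpace I x), φ x (φ x u) = -u + η x u • ξ x
  η_ξ : ∀ x : M, η x (ξ x) = 1
  inner_eq : ∀ (x : M) (u v : TangentSpace I x),
    inner ℝ u v = inner ℝ (φ x u) (φ x v) + η x u * η x v
  inner_φ_eq : ∀ (X Y : Π x : M, TangentSpace I x) (x : M), MDiffAt (T% X) x → MDiffAt (T% Y) x →
    inner ℝ (X x) (φ x (Y x)) = extDerivOneForm η X Y x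

end Contact

/-! ### Submanifolds

An (immersed) submanifold is given by an isometric immersion `f : N → M`. -/

section Submanifold

variable {E : Type*} [NormedAddCommGroup E] [NormedSpace ℝ E] [CompleteSpace E]
  [FiniteDimensional ℝ E]
  {H : Type*} [TopologicalSpace H] (I : ModelWithCorners ℝ E H)
  {M : Type*} [TopologicalSpace M] [ChartedSpace H M] [IsManifold I ∞ M]
  [RiemannianBundle (fun x : M ↦ TangentSpace I x)]
  [IsContMDiffRiemannianBundle I ∞ E (fun x : M ↦ TangentSpace I x)]
  {E' : Type*} [NormedAddCommGroup E'] [NormedSpace ℝ E'] [FiniteDimensional ℝ E']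
  {H' : Type*} [TopologicalSpace H'] (J : ModelWithCorners ℝ E' H')
  {N : Type*} [TopologicalSpace N] [ChartedSpace H' N] [IsManifold J ∞ N]
  [RiemannianBundle (fun x : N ↦ TangentSpace J x)]

/-- `f` is smooth and its differential preserves the inner products (so it is injective). -/
structure IsIsometricImmersion (f : N → M) : Prop where
  contMDiff : ContMDiff J I ∞ f
  inner_mfderiv : ∀ (x : N) (u v : TangentSpace J x),
    (inner ℝ (mfderiv J I f x u) (mfderiv J I f x v) : ℝ) = inner ℝ u v

/-- The covariant derivative `∇_u V` at `x`, for the connection induced by the Levi-Civita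
connection of `M` along the map `f : N → M`, of a vector field `V` along `f`. If `(sᵢ)` is a local
frame of `TM` near `f x` and `V = ∑ aᵢ (sᵢ ∘ f)` near `x`, it is
`∑ (u(aᵢ) sᵢ + aᵢ ∇_{df u} sᵢ)`. The frame used is that of the chart at `f x`. -/
noncomputable def covAlong (f : N → M) (V : Π y : N, TangentSpace I (f y)) (x : N)
    (u : TangentSpace J x) : TangentSpace I (f x) :=
  let e := trivializationAt E (fun z : M ↦ TangentSpace I z) (f x)
  let b := Module.finBasis ℝ E
  ∑ i, (mvfderiv J (fun y ↦ e.localFrameCoeff I b i (f y) (V y)) x u • e.localFrame b i (f x)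
    + e.localFrameCoeff I b i (f x) (V x) •
      leviCivita I M (e.localFrame b i) (f x) (mfderiv J I f x u))

/-- The tangent space of the submanifold, as a subspace of the tangent space of the ambient
manifold. -/
noncomputable def tangentSubspace (f : N → M) (x : N) : Submodule ℝ (TangentSpace I (f x)) :=
  (mfderiv J I f x : TangentSpace J x →ₗ[ℝ] TangentSpace I (f x)).range

/-- The second fundamental form `σ(u, v)`: the normal component of `∇_u V`, where `V` is any
extension of `v` to a vector field on the submanifold (here the one that is constant in the chart at
`x`). -/
noncomputable def secondFundamentalForm (f : N → M) (x : N) (u v : TangentSpace J x) :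
    TangentSpace I (f x) :=
  (tangentSubspace I J f x)ᗮ.starProjection
    (covAlong I J f (fun y ↦ mfderiv J I f y (FiberBundle.extend E' v y)) x u)

/-- The mean curvature vector `H`, with `n H = trace σ`, where `n` is the dimension of the
submanifold. -/
noncomputable def meanCurvature (f : N → M) (x : N) : TangentSpace I (f x) :=
  (Module.finrank ℝ E' : ℝ)⁻¹ •
    ∑ i, secondFundamentalForm I J f x (stdOrthonormalBasis ℝ (TangentSpace J x) i)
      (stdOrthonormalBasis ℝ (TangentSpace J x) i)

/-- `σ(X, Y) = ⟨X, Y⟩ H`. -/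
def IsTotallyUmbilical (f : N → M) : Prop :=
  ∀ (x : N) (u v : TangentSpace J x),
    secondFundamentalForm I J f x u v = (inner ℝ u v : ℝ) • meanCurvature I J f x

/-- `H = 0`. -/
def IsMinimal (f : N → M) : Prop :=
  ∀ x : N, meanCurvature I J f x = 0

/-- `σ = 0`. -/
def IsTotallyGeodesic (f : N → M) : Prop :=
  ∀ (x : N) (u v : TangentSpace J x), secondFundamentalForm I J f x u v = 0

end Submanifold

end SubmanifoldGeometry

open SubmanifoldGeometry

/-!
A totally umbilical submanifold satisfies `σ(ξ, ξ) = |ξ|² H = H`, where `ξ` is regarded as a tangent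
vector field of the submanifold. On the other hand `σ(ξ, ξ)` is the normal component of the ambient
derivative `∇_ξ ξ`, and this derivative vanishes in every contact metric manifold. Hence `H = 0`,
and then `σ = ⟨ , ⟩ H = 0`.

That `∇_ξ ξ = 0` is `ContactMetricStructure.leviCivita_ξ_ξ`; it follows from the Koszul formula and
`φ ξ = 0`, `η ∘ φ = 0`, `η = ⟨ξ, ·⟩`.

The second fundamental form `σ(u, v)` is defined by extending `v` to the vector field that is constant
in a chart of the submanifold, whereas the argument above extends it by `ξ`. That the normal component
does not depend on this choice is `secondFundamentalForm_eq`. It is proved in the trivializations of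
the tangent bundles: there `ξ` along the submanifold reads `A t`, where `A` is the differential of the
immersion and `t` is the tangent field that `ξ` induces, while the other extension reads `A (t x)`.
Since `A` is smooth and injective, `t` is differentiable
(`mdifferentiableAt_of_clm_apply`), and the product rule shows that the two derivatives at `x` differ
by a vector in the range of `A x`, which is tangential.
-/

namespace SubmanifoldGeometry

/-! ### Differentiable maps from a manifold to a space of linear maps -/

section MapsToVectorSpaces

variable {E' : Type*} [NormedAddCommGroup E'] [NormedSpace ℝ E']
  {H' : Type*} [TopologicalSpace H'] {J : ModelWithCorners ℝ E' H'}
  {N : Type*} [TopologicalSpace N] [ChartedSpace H' N]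
  {F G : Type*} [NormedAddCommGroup F] [NormedSpace ℝ F] [NormedAddCommGroup G] [NormedSpace ℝ G]
  {x : N}

theorem mvfderiv_clm_apply {A : N → F →L[ℝ] G} {t : N → F} (hA : MDiffAt A x) (ht : MDiffAt t x)
    (u : TangentSpace J x) :
    d% (fun y ↦ A y (t y)) x u = A x (d% t x u) + d% A x u (t x) := by
  have h : HasMFDerivAt J 𝓘(ℝ, G) (fun y ↦ A y (t y)) x
      ((A x).comp (d% t x) + (ContinuousLinearMap.apply ℝ G (t x)).comp (d% A x)) := by
    refine ⟨(hA.clm_apply ht).continuousAt, ?_⟩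
    have := hA.hasMFDerivAt.2.clm_apply ht.hasMFDerivAt.2
    simpa only [writtenInExtChartAt, mfld_simps] using! this
  change mfderiv J 𝓘(ℝ, G) (fun y ↦ A y (t y)) x u = _
  rw [h.mfderiv]
  rfl

theorem mvfderiv_clm_comp_const (L : F →L[ℝ] G) {t : N → F} (ht : MDiffAt t x)
    (u : TangentSpace J x) : d% (fun y ↦ L (t y)) x u = L (d% t x u) := by
  have hL : MDifferentiableAt J 𝓘(ℝ, F →L[ℝ] G) (fun _ : N ↦ L) x := mdifferentiableAt_const
  have := mvfderiv_clm_apply hL ht u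
  simpa [mvfderiv_const] using this

theorem mvfderiv_congr {g g' : N → F} (h : g =ᶠ[nhds x] g') (u : TangentSpace J x) :
    d% g x u = d% g' x u := by
  have h' : mfderiv J 𝓘(ℝ, F) g x = mfderiv J 𝓘(ℝ, F) g' x := h.mfderiv_eq
  exact DFunLike.congr_fun h' u

/-- If `A t` is differentiable and `A` is differentiable with `A x` injective, then `t` is
differentiable: `A` has a differentiable family of left inverses near `x`. -/
theorem mdifferentiableAt_of_clm_apply [FiniteDimensional ℝ F] [FiniteDimensional ℝ G]
    {A : N → F →L[ℝ] G} {t : N → F} (hA : MDiffAt A x)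
    (hinj : Function.Injective (A x)) (hAt : MDiffAt (fun y ↦ A y (t y)) x) : MDiffAt t x := by
  obtain ⟨l, hl⟩ := LinearMap.exists_leftInverse_of_injective (A x : F →ₗ[ℝ] G)
    (LinearMap.ker_eq_bot.2 hinj)
  set L : G →L[ℝ] F := l.toContinuousLinearMap
  have hL : L.comp (A x) = 1 := by
    ext w
    exact LinearMap.congr_fun hl w
  have hB : MDiffAt (fun y ↦ L.comp (A y)) x := mdifferentiableAt_const.clm_comp hA
  have hu : IsUnit (L.comp (A x)) := hL ▸ isUnit_one
  have hinv : MDiffAt (fun y ↦ Ring.inverse (L.comp (A y))) x :=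
    (differentiableAt_inverse (𝕜 := ℝ) hu).comp_mdifferentiableAt (f := fun y ↦ L.comp (A y)) hB
  have hr : MDiffAt (fun y ↦ Ring.inverse (L.comp (A y)) (L (A y (t y)))) x :=
    hinv.clm_apply (mdifferentiableAt_const.clm_apply hAt)
  -- near `x`, `t` is recovered as `(L A)⁻¹ (L (A t))`, where `L` is a left inverse of `A x`
  refine hr.congr_of_eventuallyEq ?_
  have hev : ∀ᶠ y in nhds x, IsUnit (L.comp (A y)) :=
    hB.continuousAt.eventually (Units.nhds hu.unit)
  filter_upwards [hev] with y hy
  exact (DFunLike.congr_fun (Ring.inverse_mul_cancel _ hy) (t y)).symm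

end MapsToVectorSpaces

/-! ### The structure vector field of a contact metric manifold -/

section Contact

variable {E : Type*} [NormedAddCommGroup E] [NormedSpace ℝ E] [CompleteSpace E]
  [FiniteDimensional ℝ E]
  {H : Type*} [TopologicalSpace H] {I : ModelWithCorners ℝ E H}
  {M : Type*} [TopologicalSpace M] [ChartedSpace H M] [IsManifold I ∞ M]
  [RiemannianBundle (fun x : M ↦ TangentSpace I x)]

namespace ContactMetricStructure

variable (S : ContactMetricStructure I M) (x : M)

theorem φ_ξ : S.φ x (S.ξ x) = 0 := by
  have h0 : S.φ x (S.φ x (S.ξ x)) = 0 := by simp [S.φ_φ, S.η_ξ]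
  have h1 := S.φ_φ x (S.φ x (S.ξ x))
  rw [h0, map_zero] at h1
  have h2 : S.φ x (S.ξ x) = S.η x (S.φ x (S.ξ x)) • S.ξ x := by
    rwa [eq_comm, neg_add_eq_zero] at h1
  -- so `φ ξ = c ξ` with `c = η (φ ξ)`, and `c ^ 2 ξ = φ (φ ξ) = 0`
  have h3 : (S.η x (S.φ x (S.ξ x))) * (S.η x (S.φ x (S.ξ x))) = 0 := by
    have h4 := congrArg (S.φ x) h2
    rw [h0, map_smul] at h4
    have h5 := congrArg (S.η x) h4
    simpa using h5
  rw [h2, mul_self_eq_zero.1 h3, zero_smul]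

theorem inner_ξ (u : TangentSpace I x) : inner ℝ u (S.ξ x) = S.η x u := by
  rw [S.inner_eq, S.φ_ξ, inner_zero_right, S.η_ξ, zero_add, mul_one]

theorem η_φ (u : TangentSpace I x) : S.η x (S.φ x u) = 0 := by
  have h1 := S.φ_φ x (S.φ x u)
  rw [S.φ_φ x u, map_add, map_smul, S.φ_ξ, smul_zero, add_zero, map_neg, left_eq_add] at h1
  simpa [S.η_ξ] using congrArg (S.η x) h1

theorem mdifferentiableAt_ξ : MDiffAt (T% S.ξ) x :=
  (S.contMDiff_ξ x).mdifferentiableAt (by simp)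

variable [IsContMDiffRiemannianBundle I ∞ E (fun x : M ↦ TangentSpace I x)]

/-- The integral curves of `ξ` are geodesics. Since `η = ⟨ξ, ·⟩` and `|ξ| = 1`, the Koszul formula
gives `⟨∇_ξ ξ, Z⟩ = 2 dη(ξ, Z) = 2 ⟨ξ, φ Z⟩ = 0`. -/
theorem leviCivita_ξ_ξ : leviCivita I M S.ξ x (S.ξ x) = 0 := by
  refine koszul_ext fun Z hZ ↦ ?_
  have hξ := S.mdifferentiableAt_ξ x
  rw [inner_leviCivita hξ hξ hZ, inner_zero_left]
  have hη : extDerivOneForm S.η S.ξ Z x = 0 := by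
    rw [← S.inner_φ_eq S.ξ Z x hξ hZ, real_inner_comm, S.inner_ξ, S.η_φ]
  have e : (fun y ↦ (inner ℝ (S.ξ y) (Z y) : ℝ)) = fun y ↦ S.η y (Z y) := by
    ext y
    rw [real_inner_comm, S.inner_ξ]
  simp only [extDerivOneForm, S.η_ξ, mvfderiv_const] at hη
  simp only [koszul, e, S.inner_ξ, S.η_ξ, mvfderiv_const, mlieBracket_self]
  simp at hη ⊢
  linarith

end ContactMetricStructure

end Contact

/-! ### The covariant derivative along a map -/

section Submanifold

variable {E : Type*} [NormedAddCommGroup E] [NormedSpace ℝ E] [CompleteSpace E]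
  [FiniteDimensional ℝ E]
  {H : Type*} [TopologicalSpace H] {I : ModelWithCorners ℝ E H}
  {M : Type*} [TopologicalSpace M] [ChartedSpace H M] [IsManifold I ∞ M]
  [RiemannianBundle (fun x : M ↦ TangentSpace I x)]
  [IsContMDiffRiemannianBundle I ∞ E (fun x : M ↦ TangentSpace I x)]
  {E' : Type*} [NormedAddCommGroup E'] [NormedSpace ℝ E'] [FiniteDimensional ℝ E']
  {H' : Type*} [TopologicalSpace H'] {J : ModelWithCorners ℝ E' H'}
  {N : Type*} [TopologicalSpace N] [ChartedSpace H' N] [IsManifold J ∞ N]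
  [RiemannianBundle (fun x : N ↦ TangentSpace J x)]
  {f : N → M} {x : N}

variable (I f x) in
/-- The vector field `V` along `f`, read in the trivialization of `TM` used by `covAlong`. -/
noncomputable def coordAlong (V : Π y : N, TangentSpace I (f y)) (y : N) : E :=
  (trivializationAt E (fun z : M ↦ TangentSpace I z) (f x) ⟨f y, V y⟩).2

/-- The covariant derivative along `f` as the derivative of the coordinates plus a term that
depends only on the value of `V` at `x`. Hence for two fields with the same value at `x`, the
covariant derivatives differ only by the difference of the derivatives of the coordinates. -/
theorem covAlong_eq (hf : ContinuousAt f x) {V : Π y : N, TangentSpace I (f y)}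
    (hV : MDiffAt (coordAlong I f x V) x) (u : TangentSpace J x) :
    covAlong I J f V x u =
      (trivializationAt E (fun z : M ↦ TangentSpace I z) (f x)).symmL ℝ (f x)
        (d% (coordAlong I f x V) x u) +
      ∑ i, (trivializationAt E (fun z : M ↦ TangentSpace I z) (f x)).localFrameCoeff I
        (Module.finBasis ℝ E) i (f x) (V x) • leviCivita I M
          ((trivializationAt E (fun z : M ↦ TangentSpace I z) (f x)).localFrame
            (Module.finBasis ℝ E) i) (f x) (mfderiv J I f x u) := by
  set e := trivializationAt E (fun z : M ↦ TangentSpace I z) (f x) with he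
  set b := Module.finBasis ℝ E
  have hx : f x ∈ e.baseSet := FiberBundle.mem_baseSet_trivializationAt' (f x)
  have hev : ∀ᶠ y in nhds x, f y ∈ e.baseSet := hf.eventually (e.open_baseSet.mem_nhds hx)
  simp only [covAlong, Finset.sum_add_distrib]
  congr 1
  have h1 : ∀ i, mvfderiv J (fun y ↦ e.localFrameCoeff I b i (f y) (V y)) x u =
      b.repr (d% (coordAlong I f x V) x u) i := by
    intro i
    have := mvfderiv_clm_comp_const (b.coord i).toContinuousLinearMap hV u
    simp only [LinearMap.coe_toContinuousLinearMap', Module.Basis.coord_apply] at this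
    rw [← this]
    refine mvfderiv_congr ?_ u
    filter_upwards [hev] with y hy
    -- the coefficient at `f y` depends only on `V y`, so any section through `V y` computes it
    have := e.localFrameCoeff_eq_coeff (I := I) (b := b) (s := FiberBundle.extend E (V y)) hy
      (i := i)
    simpa [coordAlong] using this
  conv_rhs => rw [← b.sum_repr (d% (coordAlong I f x V) x u), map_sum]
  refine Finset.sum_congr rfl fun i _ ↦ ?_
  change mvfderiv J (fun y ↦ e.localFrameCoeff I b i (f y) (V y)) x u •
    e.localFrame b i (f x) = _
  rw [map_smul, h1, e.localFrame_apply_of_mem_baseSet b hx, Trivialization.symmL_apply _ hx]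
  rfl

theorem coordAlong_comp_mdifferentiableAt {X : Π z : M, TangentSpace I z}
    (hf : MDifferentiableAt J I f x) (hX : MDiffAt (T% X) (f x)) :
    MDiffAt (coordAlong I f x fun y ↦ X (f y)) x :=
  ((mdifferentiableAt_section I X).1 hX).comp x hf

theorem leviCivita_sum {ι : Type*} (s : Finset ι) {X : ι → Π z : M, TangentSpace I z} {z : M}
    (hX : ∀ i, MDiffAt (T% (X i)) z) :
    leviCivita I M (∑ i ∈ s, X i) z = ∑ i ∈ s, leviCivita I M (X i) z := by
  classical
  induction s using Finset.induction_on with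
  | empty => simp [CovariantDerivative.zero]
  | insert a s ha ih =>
    rw [Finset.sum_insert ha, Finset.sum_insert ha, ← ih]
    refine (leviCivita I M).isCovariantDerivativeOnUniv.add (hX a) ?_ trivial
    simpa [Finset.sum_apply] using MDifferentiableAt.sum_section fun i (_ : i ∈ s) ↦ hX i

/-- For the restriction `X ∘ f` of a vector field `X` on the ambient manifold, the covariant
derivative along `f` is given by the Levi-Civita connection. -/
theorem covAlong_comp {X : Π z : M, TangentSpace I z}
    (hf : MDifferentiableAt J I f x) (hX : MDiffAt (T% X) (f x)) (u : TangentSpace J x) :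
    covAlong I J f (fun y ↦ X (f y)) x u = leviCivita I M X (f x) (mfderiv J I f x u) := by
  set e := trivializationAt E (fun z : M ↦ TangentSpace I z) (f x) with he
  set b := Module.finBasis ℝ E
  have hx : f x ∈ e.baseSet := FiberBundle.mem_baseSet_trivializationAt' (f x)
  have hs : ∀ i, MDiffAt (T% (e.localFrame b i)) (f x) := fun i ↦
    (contMDiffAt_localFrame_of_mem 1 e b i hx).mdifferentiableAt one_ne_zero
  have hc : ∀ i, MDiffAt (fun z ↦ e.localFrameCoeff I b i z (X z)) (f x) := fun i ↦
    mdifferentiableAt_localFrameCoeff b hx hX i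
  have hcs : ∀ i, MDiffAt (T% ((fun z ↦ e.localFrameCoeff I b i z (X z)) • e.localFrame b i))
      (f x) := fun i ↦ (hc i).smul_section (hs i)
  have hsum : leviCivita I M X (f x) =
      leviCivita I M (∑ i, (fun z ↦ e.localFrameCoeff I b i z (X z)) • e.localFrame b i) (f x) := by
    refine (leviCivita I M).isCovariantDerivativeOnUniv.congr_of_eventuallyEq hX ?_
      Filter.univ_mem ?_
    · simpa [Finset.sum_apply] using
        MDifferentiableAt.sum_section fun i (_ : i ∈ Finset.univ) ↦ hcs i
    · filter_upwards [e.open_baseSet.mem_nhds hx] with z hz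
      simpa [Finset.sum_apply] using e.eq_sum_localFrameCoeff_smul (I := I) (b := b) (s := X) hz
  rw [hsum, leviCivita_sum _ hcs]
  simp only [covAlong, ← he, sum_apply]
  refine Finset.sum_congr rfl fun i _ ↦ ?_
  rw [(leviCivita I M).isCovariantDerivativeOnUniv.leibniz (hs i) (hc i) trivial]
  have := mvfderiv_comp_apply x (hc i) hf u
  simp only [Function.comp_def] at this
  rw [this]
  simp
  exact add_comm ..

/-! ### The second fundamental form and its extensions -/

variable (I J f x) in
/-- The differential of `f` near `x`, read in the trivializations at `x` and at `f x`. -/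
noncomputable def coordMFDeriv (y : N) : E' →L[ℝ] E :=
  inTangentCoordinates J I id f (mfderiv J I f) x y

theorem mdifferentiableAt_coordMFDeriv (hf : ContMDiff J I ∞ f) :
    MDiffAt (coordMFDeriv I J f x) x :=
  ((hf x).mfderiv_const (m := ∞) (by norm_cast)).mdifferentiableAt (by simp)

theorem coordMFDeriv_eq {y : N}
    (hy : y ∈ (trivializationAt E' (fun z : N ↦ TangentSpace J z) x).baseSet)
    (hfy : f y ∈ (trivializationAt E (fun z : M ↦ TangentSpace I z) (f x)).baseSet) :
    coordMFDeriv I J f x y =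
      ((trivializationAt E (fun z : M ↦ TangentSpace I z) (f x)).continuousLinearEquivAt ℝ (f y) hfy
        : TangentSpace I (f y) →L[ℝ] E) ∘L mfderiv J I f y ∘L
      ((trivializationAt E' (fun z : N ↦ TangentSpace J z) x).continuousLinearEquivAt ℝ y hy).symm :=
  ContinuousLinearMap.inCoordinates_eq hy hfy

theorem coordMFDeriv_apply {y : N}
    (hy : y ∈ (trivializationAt E' (fun z : N ↦ TangentSpace J z) x).baseSet)
    (hfy : f y ∈ (trivializationAt E (fun z : M ↦ TangentSpace I z) (f x)).baseSet) (w : E') :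
    coordMFDeriv I J f x y w = (trivializationAt E (fun z : M ↦ TangentSpace I z) (f x)
      ⟨f y, mfderiv J I f y ((trivializationAt E' (fun z : N ↦ TangentSpace J z) x).symm y w)⟩).2 :=
  DFunLike.congr_fun (coordMFDeriv_eq hy hfy) w

theorem IsIsometricImmersion.injective_mfderiv (hf : IsIsometricImmersion I J f) (x : N) :
    Function.Injective (mfderiv J I f x) := by
  rw [injective_iff_map_eq_zero]
  intro u hu
  rw [← inner_self_eq_zero (𝕜 := ℝ), ← hf.inner_mfderiv x u u, hu, inner_zero_left]

/-- If a vector field `X` of the ambient manifold is tangent to the submanifold along it, then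
`σ(u, X)` is the normal component of `∇_u X`. In other words, the second fundamental form may be
computed with the extension `X` of its second argument, instead of the one that is constant in the
chart at `x`. -/
theorem secondFundamentalForm_eq (hf : IsIsometricImmersion I J f)
    {X : Π z : M, TangentSpace I z} (hX : MDiffAt (T% X) (f x))
    (hXt : ∀ y, X (f y) ∈ tangentSubspace I J f y) (u v : TangentSpace J x)
    (hv : mfderiv J I f x v = X (f x)) :
    secondFundamentalForm I J f x u v =
      (tangentSubspace I J f x)ᗮ.starProjection
        (leviCivita I M X (f x) (mfderiv J I f x u)) := by
  -- `T` is the vector field on the submanifold with `df T = X ∘ f`, and `t` its coordinates; nothing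
  -- is known about its regularity at first
  choose T hT using hXt
  have hT : ∀ y, mfderiv J I f y (T y) = X (f y) := hT
  have hfd : MDifferentiableAt J I f x := (hf.contMDiff x).mdifferentiableAt (by simp)
  have hTx : T x = v := hf.injective_mfderiv x ((hT x).trans hv.symm)
  set e := trivializationAt E (fun z : M ↦ TangentSpace I z) (f x) with he
  set e' := trivializationAt E' (fun z : N ↦ TangentSpace J z) x with he'
  have hx : f x ∈ e.baseSet := FiberBundle.mem_baseSet_trivializationAt' (f x)
  have hx' : x ∈ e'.baseSet := FiberBundle.mem_baseSet_trivializationAt' x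
  have hev : ∀ᶠ y in nhds x, f y ∈ e.baseSet ∧ y ∈ e'.baseSet :=
    (hfd.continuousAt.eventually (e.open_baseSet.mem_nhds hx)).and (e'.open_baseSet.mem_nhds hx')
  let t : N → E' := fun y ↦ (e' ⟨y, T y⟩).2
  let V : Π y : N, TangentSpace I (f y) := fun y ↦ mfderiv J I f y (FiberBundle.extend E' v y)
  let W : Π y : N, TangentSpace I (f y) := fun y ↦ X (f y)
  have hA := mdifferentiableAt_coordMFDeriv (x := x) hf.contMDiff
  have hAV : coordAlong I f x V =ᶠ[nhds x] fun y ↦ coordMFDeriv I J f x y (t x) := by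
    filter_upwards [hev] with y hy
    rw [coordMFDeriv_apply hy.2 hy.1]
    simp only [coordAlong, V, t, hTx]
    rfl
  have hAW : coordAlong I f x W =ᶠ[nhds x] fun y ↦ coordMFDeriv I J f x y (t y) := by
    filter_upwards [hev] with y hy
    rw [coordMFDeriv_apply hy.2 hy.1]
    simp only [coordAlong, W, t]
    rw [e'.symm_apply_apply_mk hy.2, hT]
  have hinj : Function.Injective (coordMFDeriv I J f x x) := by
    rw [coordMFDeriv_eq hx' hx]
    exact (e.continuousLinearEquivAt ℝ (f x) hx).injective.comp
      ((hf.injective_mfderiv x).comp (e'.continuousLinearEquivAt ℝ x hx').symm.injective)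
  have hW : MDiffAt (coordAlong I f x W) x := coordAlong_comp_mdifferentiableAt hfd hX
  have ht : MDiffAt t x :=
    mdifferentiableAt_of_clm_apply hA hinj (hW.congr_of_eventuallyEq hAW.symm)
  have htx : MDifferentiableAt J 𝓘(ℝ, E') (fun _ : N ↦ t x) x := mdifferentiableAt_const
  have hV : MDiffAt (coordAlong I f x V) x :=
    (hA.clm_apply htx).congr_of_eventuallyEq hAV
  have hVW : V x = W x := by
    simp only [V, W, FiberBundle.extend_apply_self, hv]
  -- the two extensions differ by `df (v - T)` with `v - T` vanishing at `x`, so that their covariant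
  -- derivatives differ by the tangential vector `df (∂_u t)`
  have hcov : covAlong I J f V x u = leviCivita I M X (f x) (mfderiv J I f x u) -
      mfderiv J I f x (e'.symm x (d% t x u)) := by
    rw [← covAlong_comp hfd hX, covAlong_eq hfd.continuousAt hV u,
      covAlong_eq hfd.continuousAt hW u, mvfderiv_congr hAV, mvfderiv_congr hAW,
      mvfderiv_clm_apply hA htx, mvfderiv_clm_apply hA ht, mvfderiv_const, hVW]
    have hsymm : e.symmL ℝ (f x) (coordMFDeriv I J f x x (d% t x u)) =
        mfderiv J I f x (e'.symm x (d% t x u)) := by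
      rw [coordMFDeriv_apply hx' hx, Trivialization.symmL_apply _ hx, e.symm_apply_apply_mk hx]
    rw [← hsymm]
    simp only [_root_.zero_apply, map_zero, map_add, zero_add, ← he]
    abel
  change (tangentSubspace I J f x)ᗮ.starProjection (covAlong I J f V x u) = _
  rw [hcov, map_sub, sub_eq_self, Submodule.starProjection_apply_eq_zero_iff]
  exact Submodule.le_orthogonal_orthogonal _ ⟨_, rfl⟩

end Submanifold

end SubmanifoldGeometry

theorem proposition4p1 {m n : ℕ}
    {M' : Type*} [TopologicalSpace M'] [ChartedSpace (EuclideanSpace ℝ (Fin (2 * m + 1))) M']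
    [IsManifold (𝓡 (2 * m + 1)) ∞ M']
    [RiemannianBundle (fun x : M' ↦ TangentSpace (𝓡 (2 * m + 1)) x)]
    [IsContMDiffRiemannianBundle (𝓡 (2 * m + 1)) ∞ (EuclideanSpace ℝ (Fin (2 * m + 1)))
      (fun x : M' ↦ TangentSpace (𝓡 (2 * m + 1)) x)]
    (S : ContactMetricStructure (𝓡 (2 * m + 1)) M')
    {M : Type*} [TopologicalSpace M] [ChartedSpace (EuclideanSpace ℝ (Fin n)) M]
    [IsManifold (𝓡 n) ∞ M]
    [RiemannianBundle (fun x : M ↦ TangentSpace (𝓡 n) x)]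
    [IsContMDiffRiemannianBundle (𝓡 n) ∞ (EuclideanSpace ℝ (Fin n))
      (fun x : M ↦ TangentSpace (𝓡 n) x)]
    (f : M → M') (hf : IsIsometricImmersion (𝓡 (2 * m + 1)) (𝓡 n) f)
    (hξ : ∀ x : M, S.ξ (f x) ∈ tangentSubspace (𝓡 (2 * m + 1)) (𝓡 n) f x)
    (humb : IsTotallyUmbilical (𝓡 (2 * m + 1)) (𝓡 n) f) :
    IsMinimal (𝓡 (2 * m + 1)) (𝓡 n) f ∧ IsTotallyGeodesic (𝓡 (2 * m + 1)) (𝓡 n) f := by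
  have hmin : IsMinimal (𝓡 (2 * m + 1)) (𝓡 n) f := by
    intro x
    obtain ⟨v, hv⟩ := hξ x
    have hv : mfderiv (𝓡 n) (𝓡 (2 * m + 1)) f x v = S.ξ (f x) := hv
    have hσ := secondFundamentalForm_eq hf (S.mdifferentiableAt_ξ (f x)) hξ v v hv
    rw [hv, S.leviCivita_ξ_ξ, map_zero, humb, ← hf.inner_mfderiv x v v, hv, S.inner_ξ, S.η_ξ,
      one_smul] at hσ
    exact hσ
  refine ⟨hmin, fun x u v ↦ ?_⟩
  rw [humb, hmin, smul_zero]
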